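/- **Setting.** A network $G=(V,E,s,t,c,e)$ consists of a finite set $V$, a symmetric edge set $E\subset V\times V$, a source and a sink $s\neq t$ in $V$, capacities $c\colon E\to\mathbb{N}_0$ and excesses $e\colon V\setminus\{s,t\}\to\mathbb{N}_0$ (with $e(s)=\infty$, $e(t)=0$). For an antisymmetric $f\colon E\to\mathbb{Z}$ the residual network $G_f$ has capacities $c_f=c-f$ and excesses $e_f(v)=e(v)+\sum_{u:(u,v)\in E}f(u,v)$ for $v\neq t$. We write $u\to Y$ if some vertex of $Y$ can be reached from $u$ by a path (possibly of length $0$) of edges of positive capacity. Let $(R_k)_{k=1}^K$ be a partition of $V\setminus\{s,t\}$ into regions. For a region $R$ let $B^R=\{w\notin R\cup\{s,t\} : (u,w)\in E \text{ for some } u\in R\}$; put $\mathcal{B}=\bigcup_k B^{R_k}$ and $d^\infty=|\mathcal{B}|$. The region network $G^R$ has vertices $R\cup B^R\cup\{s,t\}$ and the edges of $E$ inside $R\cup\{s,t\}$ and between $R$ and $B^R$ in either direction; it inherits $c$ and $e|_{R\cup\{s,t\}}$, except that edges from $B^R$ to $R$ get capacity $0$. A vertex $v\neq s,t$ is active if $e(v)>0$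 and $d(v)<d^\infty$. **ARD$(G^R,d)$.** Start with $f=0$. For $k=0,1,\dots,d^\infty$, let $T_k=\{t\}\cup\{v\in B^R: d(v)<k\}$ and, as long as possible, choose any simple path $(v_0,\dots,v_l)$ of edges of positive residual capacity in $G^R_f$ with $v_0\in R$, $e_f(v_0)>0$, $v_l\in T_k$, and augment $f$ along it by $\min(e_f(v_0),\min_i c_f(v_{i-1},v_i))$ units. Let $f'$ be the final flow. The labels are $d'(u)=\min\{k: u\to T_k \text{ in } G^R_{f'}\}$ if $u\in R$ and $u\to T_{d^\infty}$, $d'(u)=d^\infty$ if $u\in R$ and $u\nrightarrow T_{d^\infty}$, and $d'=d$ on $B^R$. Return $(f',d')$. **P-ARD.** Initially, saturate all edges from $s$ to other vertices and replace $G$ by the residual network; set $d(s)=d^\infty$ and $d(v)=0$ for $v\neq s$. While there are active vertices, perform a sweep: 1. compute $(f'_k,d'_k)=\mathrm{ARD}(G^{R_k},d)$ for all $k$ concurrently; 2. fuse the labels: $d'=d'_k$ on $R_k$ for all $k$, and $d'=d$ on $\{s,t\}$; 3. with $\alpha(u,v)=1$ if $d'(u)\le d'(v)+1$ and $\alpha(u,v)=0$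 otherwise, fuse the flows: $f'(u,v)=\alpha(v,u)f'_k(u,v)+\alpha(u,v)f'_j(u,v)$ on edges from $R_k$ to $R_j$ with $j\neq k$; $f'=f'_k$ on edges inside $R_k$ and on edges between $R_k$ and $\{s,t\}$; $f'=0$ on edges joining $s$ and $t$; 4. replace $G$ by $G_{f'}$ and $d$ by $d'$; 5. optionally apply the global gap heuristic: if for some $g>0$ no vertex has label $g$, set all labels greater than $g$ to $d^\infty$. **Theorem.** For every network and every partition into regions, and for all choices made in the augmentations and in the optional steps, P-ARD terminates after at most $2|\mathcal{B}|^2+1$ sweeps. In particular every sweep itself terminates: no sequence of augmentations in a stage of ARD is infinite, and every sweep that is started produces a next state. -/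

import Mathlib

namespace PARD

/-- A network `(V, E, s, t, c, e)`. The edge relation is symmetric, and `c u v` is meaningful only on
edges. The values of `e` at `s` and `t` are never read (the convention is `e s = ∞`, `e t = 0`).
Capacities and excesses are integers; that they are nonnegative is the predicate `Network.Nonneg`. -/
structure Network (V : Type*) where
  E : V → V → Prop
  symm : ∀ u v, E u v → E v u
  s : V
  t : V
  s_ne_t : s ≠ t
  c : V → V → ℤ
  e : V → ℤ

namespace Network

/-- Capacities and excesses lie in `{0, 1, 2, …}`. -/
def Nonneg {V : Type*} (N : Network V) : Prop :=
  (∀ u v, N.E u v → 0 ≤ N.c u v) ∧ ∀ v, v ≠ N.s → v ≠ N.t → 0 ≤ N.e v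

open Classical in
/-- The residual network `G_f`: `c_f = c - f`, and `e_f(v) = e(v) + ∑ f(u,v)` over edges `(u,v)`. -/
noncomputable def residual {V : Type*} [Fintype V] (N : Network V) (f : V → V → ℤ) : Network V where
  E := N.E
  symm := N.symm
  s := N.s
  t := N.t
  s_ne_t := N.s_ne_t
  c := fun u v => N.c u v - f u v
  e := fun v => N.e v + ∑ u with N.E u v, f u v

/-- `(u,v)` is an edge of strictly positive capacity. -/
def Pos {V : Type*} (N : Network V) (u v : V) : Prop := N.E u v ∧ 0 < N.c u v

/-- `u → Y`: some vertex of `Y` is reachable from `u` by a path (possibly of length `0`) of edges of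
strictly positive capacity. -/
def Reaches {V : Type*} (N : Network V) (u : V) (Y : Set V) : Prop :=
  ∃ y ∈ Y, Relation.ReflTransGen N.Pos u y

/-- The boundary of a region `A`. -/
def bdry {V : Type*} (N : Network V) (A : Set V) : Set V :=
  {w | (∃ u ∈ A, N.E u w) ∧ w ∉ A ∧ w ≠ N.s ∧ w ≠ N.t}

open Classical in
/-- The region network of `A`, with vertex set `A ∪ bdry A ∪ {s,t}`: its edges are the edges inside
`A ∪ {s,t}` and those between `A` and its boundary in either direction; the edges from the boundary
into `A` have capacity `0`. Vertices of `V` outside the vertex set of the region network are isolated. -/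
noncomputable def region {V : Type*} (N : Network V) (A : Set V) : Network V where
  E := fun u v => N.E u v ∧
    ((u ∈ A ∪ {N.s, N.t} ∧ v ∈ A ∪ {N.s, N.t}) ∨ (u ∈ A ∧ v ∈ N.bdry A) ∨ (u ∈ N.bdry A ∧ v ∈ A))
  symm := by
    rintro u v ⟨h, h'⟩
    exact ⟨N.symm u v h, by tauto⟩
  s := N.s
  t := N.t
  s_ne_t := N.s_ne_t
  c := fun u v => if u ∈ N.bdry A ∧ v ∈ A then 0 else N.c u v
  e := fun v => if v ∈ A ∪ {N.s, N.t} then N.e v else 0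

end Network

/-- The regions `R 0, …, R (K-1)` are disjoint with union `V \ {s,t}`. -/
def IsRegionPartition {V : Type*} (N : Network V) {K : ℕ} (R : Fin K → Set V) : Prop :=
  (∀ j k, j ≠ k → Disjoint (R j) (R k)) ∧ ∀ v, (∃ k, v ∈ R k) ↔ v ≠ N.s ∧ v ≠ N.t

/-- The set `𝓑` of all boundary vertices. -/
def boundary {V : Type*} (N : Network V) {K : ℕ} (R : Fin K → Set V) : Set V :=
  ⋃ k, N.bdry (R k)

/-- The maximal label `d^∞ = |𝓑|`. -/
noncomputable def dInf {V : Type*} (N : Network V) {K : ℕ} (R : Fin K → Set V) : ℕ :=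
  (boundary N R).ncard

open Classical in
/-- The unit flow along the path `p 0, p 1, …, p l` (antisymmetric). -/
noncomputable def pathFlow {V : Type*} (p : ℕ → V) (l : ℕ) (u v : V) : ℤ :=
  (if ∃ i < l, p i = u ∧ p (i + 1) = v then 1 else 0) -
    (if ∃ i < l, p i = v ∧ p (i + 1) = u then 1 else 0)

/-- One iteration of `Augment(X, Y)` in the network `M`, with current flow `f`: along a simple path of
residual edges from a vertex of `X` with positive excess to a vertex of `Y`, push as many units as the
excess of the first vertex and the residual capacities of the edges allow. -/
def AugmentStep {V : Type*} [Fintype V] (M : Network V) (X Y : Set V) (f f' : V → V → ℤ) : Prop :=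
  ∃ (l : ℕ) (p : ℕ → V) (Δ : ℤ),
    Set.InjOn p (Set.Iic l) ∧ p 0 ∈ X ∧ p l ∈ Y ∧
    0 < (M.residual f).e (p 0) ∧
    (∀ i < l, (M.residual f).Pos (p i) (p (i + 1))) ∧
    IsLeast ({(M.residual f).e (p 0)} ∪ {x | ∃ i < l, x = (M.residual f).c (p i) (p (i + 1))}) Δ ∧
    f' = fun u v => f u v + Δ * pathFlow p l u v

/-- `Augment(X, Y)`, started with the flow `f`, can stop with the flow `f'`. -/
def Augment {V : Type*} [Fintype V] (M : Network V) (X Y : Set V) (f f' : V → V → ℤ) : Prop :=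
  Relation.ReflTransGen (AugmentStep M X Y) f f' ∧ ¬ ∃ f'', AugmentStep M X Y f' f''

/-- `Augment(X, Y)`, started with the flow `f`, always stops. -/
def AugmentTerminates {V : Type*} [Fintype V] (M : Network V) (X Y : Set V) (f : V → V → ℤ) : Prop :=
  Acc (fun g' g => AugmentStep M X Y g g') f

/-- The target set `T_k` of stage `k`. -/
def target {V : Type*} (N : Network V) (A : Set V) (d : V → ℕ) (k : ℕ) : Set V :=
  {N.t} ∪ {v | v ∈ N.bdry A ∧ d v < k}

/-- `ARDStages N A d k f`: in the region network of `A`, the flow can be `f` after the stages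
`0, …, k-1` of ARD, that is, at the beginning of stage `k`. -/
inductive ARDStages {V : Type*} [Fintype V] (N : Network V) (A : Set V) (d : V → ℕ) :
    ℕ → (V → V → ℤ) → Prop
  | zero : ARDStages N A d 0 (fun _ _ => 0)
  | succ {k : ℕ} {f f' : V → V → ℤ} : ARDStages N A d k f →
      Augment (N.region A) A (target N A d k) f f' → ARDStages N A d (k + 1) f'

open Classical in
/-- The region-relabel step of ARD, in the residual region network of the flow `f`. -/
noncomputable def regionRelabel {V : Type*} [Fintype V] (N : Network V) (A : Set V) (D : ℕ)
    (d : V → ℕ) (f : V → V → ℤ) (u : V) : ℕ :=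
  if u ∈ A then
    if ((N.region A).residual f).Reaches u (target N A d D) then
      sInf {k | ((N.region A).residual f).Reaches u (target N A d k)}
    else D
  else d u

/-- `(f', d')` is a possible output of ARD on the region network of `A` with labels `d`, where `D` is
the maximal label: stages `0, …, D`, followed by region-relabel. -/
def ARD {V : Type*} [Fintype V] (N : Network V) (A : Set V) (D : ℕ) (d : V → ℕ)
    (f' : V → V → ℤ) (d' : V → ℕ) : Prop :=
  ARDStages N A d (D + 1) f' ∧ d' = regionRelabel N A D d f'

/-- A state of the algorithm between sweeps: the current network and the current labels. -/
structure AlgState (V : Type*) where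
  net : Network V
  d : V → ℕ

open Classical in
/-- The preflow saturating all edges out of the source. -/
noncomputable def saturate {V : Type*} (N : Network V) (u v : V) : ℤ :=
  if u = N.s ∧ v ≠ N.s ∧ N.E u v then N.c u v
  else if v = N.s ∧ u ≠ N.s ∧ N.E v u then - N.c v u
  else 0

open Classical in
/-- `Init()`. -/
noncomputable def initState {V : Type*} [Fintype V] (N : Network V) {K : ℕ} (R : Fin K → Set V) :
    AlgState V where
  net := N.residual (saturate N)
  d := fun v => if v = N.s then dInf N R else 0

/-- There is an active vertex. The source (of label `d^∞`) and the sink (of excess `0`) never are. -/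
def HasActive {V : Type*} {K : ℕ} (R : Fin K → Set V) (S : AlgState V) : Prop :=
  ∃ v, v ≠ S.net.s ∧ v ≠ S.net.t ∧ 0 < S.net.e v ∧ S.d v < dInf S.net R

open Classical in
/-- `α(u,v) = [d'(u) ≤ d'(v) + 1]`. -/
noncomputable def validPair {V : Type*} (d' : V → ℕ) (u v : V) : ℤ :=
  if d' u ≤ d' v + 1 then 1 else 0

/-- `d'` is the labeling fused from the labelings `dk k` of the regions. -/
def FusedLabels {V : Type*} {K : ℕ} (R : Fin K → Set V) (d : V → ℕ) (dk : Fin K → V → ℕ)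
    (d' : V → ℕ) : Prop :=
  (∀ k, ∀ v ∈ R k, d' v = dk k v) ∧ ∀ v, (∀ k, v ∉ R k) → d' v = d v

/-- `f'` is the flow fused from the flows `fk k` of the regions, with respect to the fused labels `d'`.
Besides the edges between two regions and the edges inside a region, there are the edges between a
region and the terminals, which belong to the network of that region only, and the edges joining the
two terminals, on which nothing is ever sent. -/
def FusedFlow {V : Type*} (N : Network V) {K : ℕ} (R : Fin K → Set V) (d' : V → ℕ)
    (fk : Fin K → V → V → ℤ) (f' : V → V → ℤ) : Prop :=
  (∀ k j, k ≠ j → ∀ u ∈ R k, ∀ v ∈ R j,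
    f' u v = validPair d' v u * fk k u v + validPair d' u v * fk j u v) ∧
  (∀ k, ∀ u ∈ R k, ∀ v ∈ R k, f' u v = fk k u v) ∧
  (∀ k, ∀ u ∈ R k, ∀ v, v = N.s ∨ v = N.t → f' u v = fk k u v ∧ f' v u = fk k v u) ∧
  (∀ u v, u = N.s ∨ u = N.t → v = N.s ∨ v = N.t → f' u v = 0)

open Classical in
/-- The (optional) global gap heuristic: either it is not applied, or no vertex has label `g > 0` and
all labels above `g` are raised to the maximal label `D`. -/
def GlobalGap {V : Type*} (D : ℕ) (d d' : V → ℕ) : Prop :=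
  d' = d ∨ ∃ g, 0 < g ∧ (∀ v, d v ≠ g) ∧ d' = fun v => if g < d v then D else d v

/-- One sweep of the parallel algorithm with ARD can lead from the state `S` to the state `S'`. -/
def Sweep {V : Type*} [Fintype V] {K : ℕ} (R : Fin K → Set V) (S S' : AlgState V) : Prop :=
  ∃ (fk : Fin K → V → V → ℤ) (dk : Fin K → V → ℕ) (f' : V → V → ℤ) (d' : V → ℕ),
    (∀ k, ARD S.net (R k) (dInf S.net R) S.d (fk k) (dk k)) ∧
    FusedLabels R S.d dk d' ∧
    FusedFlow S.net R d' fk f' ∧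
    S'.net = S.net.residual f' ∧
    GlobalGap (dInf S.net R) d' S'.d

/-- One iteration of the main loop: there are active vertices, and a sweep is made. -/
def LoopStep {V : Type*} [Fintype V] {K : ℕ} (R : Fin K → Set V) (S S' : AlgState V) : Prop :=
  HasActive R S ∧ Sweep R S S'

end PARD

/-!
Call a vertex eligible if it has positive excess and is active or reaches the target set in its
region network. Let `M` be the largest label of an eligible vertex and `Σ` the sum of the labels
over `𝓑`. The point is that `M - Σ` strictly decreases in every sweep after the first.

When ARD stops, its vertices of positive excess reach no target. So a vertex `v` that is eligible
after the sweep is connected, along edges on which labels do not decrease, to a vertex where the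
fused flow exceeds the flow of its own region. The surplus is flow that entered from another region
or flow to another region that the fusion cancelled, and in both cases some region sent flow to a
boundary vertex `u` whose new label is at least that of `v`. The flow into `u` is sent in a stage
after `d(u)`, by a vertex `x` that was eligible before the sweep and no longer reaches the target
set of stage `d(u)`. Hence the new label of `x` exceeds `d(u)`, and the rise of the labels of `u`
and `x` in `Σ` outweighs a possible gain of `v` over `x` in `M`. This uses that `x`, if active, is a
boundary vertex, which holds after the first sweep because active vertices have received flow from
another region.

Since `M - Σ ≤ |𝓑|` after the first sweep and `M - Σ > -|𝓑|²` while there are active vertices, at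
most `|𝓑|² + |𝓑| + 1` sweeps are made.

A single augmentation loop terminates because each augmentation lowers the total excess of its
region.
-/

namespace PARD

variable {V : Type*}

section Paths

theorem exists_injOn_path_of_reflTransGen {r : V → V → Prop} {a b : V}
    (h : Relation.ReflTransGen r a b) :
    ∃ (l : ℕ) (p : ℕ → V), Set.InjOn p (Set.Iic l) ∧ p 0 = a ∧ p l = b ∧
      ∀ i < l, r (p i) (p (i + 1)) := by
  induction h using Relation.ReflTransGen.head_induction_on with
  | refl => exact ⟨0, fun _ => b, by simp [Set.InjOn], rfl, rfl, by simp⟩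
  | @head a c hac _ ih =>
    obtain ⟨l, p, hinj, rfl, rfl, hp⟩ := ih
    by_cases ha : ∃ i ≤ l, p i = a
    · obtain ⟨i, hi, rfl⟩ := ha
      refine ⟨l - i, fun n => p (i + n), fun m hm n hn hmn => ?_, rfl,
        congrArg p (Nat.add_sub_cancel' hi), fun n hn => hp (i + n) (by omega)⟩
      rw [Set.mem_Iic] at hm hn
      exact Nat.add_left_cancel (hinj (Set.mem_Iic.2 (by omega)) (Set.mem_Iic.2 (by omega)) hmn)
    · refine ⟨l + 1, fun n => n.casesOn a p, ?_, rfl, rfl, ?_⟩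
      · rintro (_ | m) hm (_ | n) hn hmn
        · rfl
        · exact absurd ⟨n, Nat.le_of_succ_le_succ hn, hmn.symm⟩ ha
        · exact absurd ⟨m, Nat.le_of_succ_le_succ hm, hmn⟩ ha
        · exact congrArg (· + 1)
            (hinj (Nat.le_of_succ_le_succ hm) (Nat.le_of_succ_le_succ hn) hmn)
      · rintro (_ | n) hn
        · exact hac
        · exact hp n (Nat.lt_of_succ_lt_succ hn)

theorem reflTransGen_of_path {r : V → V → Prop} {p : ℕ → V} {i j : ℕ} (hij : i ≤ j)
    (h : ∀ n < j, r (p n) (p (n + 1))) : Relation.ReflTransGen r (p i) (p j) := by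
  induction j, hij using Nat.le_induction with
  | base => exact .refl
  | succ j _ ih => exact (ih fun n hn => h n (by omega)).tail (h j (by omega))

end Paths

section PathFlow

variable {p : ℕ → V} {l : ℕ}

/-- The net inflow `∑ f(u,v)` of `f` at the vertex `v`, over all vertices `u`; for a flow, whose
support consists of edges, it is the difference between the excesses `e_f(v)` and `e(v)`. -/
def inflow [Fintype V] (f : V → V → ℤ) (v : V) : ℤ := ∑ u, f u v

open Classical in
theorem ite_exists_edge_eq_sum (hp : Set.InjOn p (Set.Iic l)) (u v : V) :
    (if ∃ i < l, p i = u ∧ p (i + 1) = v then (1 : ℤ) else 0) =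
      ∑ i ∈ Finset.range l, if p i = u ∧ p (i + 1) = v then (1 : ℤ) else 0 := by
  split_ifs with h
  · obtain ⟨i, hi, rfl, rfl⟩ := h
    rw [Finset.sum_eq_single_of_mem i (Finset.mem_range.2 hi), if_pos ⟨rfl, rfl⟩]
    exact fun j hj hji => if_neg fun hj' =>
      hji (hp (Finset.mem_range.1 hj).le hi.le hj'.1)
  · exact (Finset.sum_eq_zero fun i hi => if_neg fun hi' =>
      h ⟨i, Finset.mem_range.1 hi, hi'⟩).symm

open Classical in
theorem inflow_pathFlow [Fintype V] (hp : Set.InjOn p (Set.Iic l)) (v : V) :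
    inflow (pathFlow p l) v = (if p l = v then 1 else 0) - (if p 0 = v then 1 else 0) := by
  simp only [inflow, pathFlow, ite_exists_edge_eq_sum hp, Finset.sum_sub_distrib]
  rw [Finset.sum_comm, Finset.sum_comm (s := Finset.univ) (t := Finset.range l),
    ← Finset.sum_sub_distrib, ← Finset.sum_range_sub (fun i => if p i = v then (1 : ℤ) else 0) l]
  refine Finset.sum_congr rfl fun i _ => congrArg₂ _ ?_ ?_
  · by_cases h : p (i + 1) = v <;> simp [h]
  · by_cases h : p i = v <;> simp [h]

theorem pathFlow_antisymm (u v : V) : pathFlow p l u v = -pathFlow p l v u := by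
  simp only [pathFlow, neg_sub]

theorem pathFlow_le_one (u v : V) : pathFlow p l u v ≤ 1 := by
  simp only [pathFlow]; split_ifs <;> norm_num

theorem exists_edge_of_pathFlow_pos {u v : V} (h : 0 < pathFlow p l u v) :
    ∃ i < l, p i = u ∧ p (i + 1) = v := by
  by_contra h'
  simp only [pathFlow, if_neg h'] at h
  split_ifs at h <;> omega

theorem exists_edge_of_pathFlow_neg {u v : V} (h : pathFlow p l u v < 0) :
    ∃ i < l, p i = v ∧ p (i + 1) = u :=
  exists_edge_of_pathFlow_pos (by rwa [pathFlow_antisymm, neg_pos])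

end PathFlow

section Reachability

variable {N : Network V} {u v : V} {S T : Set V}

theorem Network.Reaches.mono (h : N.Reaches u S) (hST : S ⊆ T) : N.Reaches u T :=
  let ⟨y, hy, huy⟩ := h
  ⟨y, hST hy, huy⟩

theorem Network.Reaches.of_reflTransGen (h : Relation.ReflTransGen N.Pos u v)
    (hv : N.Reaches v T) : N.Reaches u T :=
  let ⟨y, hy, hvy⟩ := hv
  ⟨y, hy, h.trans hvy⟩

theorem Network.Reaches.head (h : N.Pos u v) (hv : N.Reaches v T) : N.Reaches u T :=
  .of_reflTransGen (.single h) hv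

theorem Network.reaches_of_mem (h : u ∈ T) : N.Reaches u T := ⟨u, h, .refl⟩

end Reachability

section Flow

variable {M : Network V} {X Y : Set V} {f : V → V → ℤ}

/-- An antisymmetric function supported on the edges and respecting the capacities. Preflows are
flows in this sense: there is no conservation law. -/
structure IsFlow (M : Network V) (f : V → V → ℤ) : Prop where
  antisymm : ∀ u v, f u v = -f v u
  support : ∀ u v, ¬ M.E u v → f u v = 0
  capacity : ∀ u v, M.E u v → f u v ≤ M.c u v

theorem IsFlow.nonneg_of_not_pos (hf : IsFlow M f) {u v : V} (h : ¬ M.Pos u v) : 0 ≤ f v u := by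
  rw [hf.antisymm v u, neg_nonneg]
  by_cases hE : M.E u v
  · exact (hf.capacity u v hE).trans (not_lt.1 fun hc => h ⟨hE, hc⟩)
  · exact (hf.support u v hE).le

variable [Fintype V]

theorem IsFlow.residual_e (hf : IsFlow M f) (v : V) :
    (M.residual f).e v = M.e v + inflow f v :=
  congrArg (M.e v + ·) (Finset.sum_subset (Finset.subset_univ _) fun u _ hu =>
    hf.support u v (by simpa using hu))

theorem Network.residual_pos_iff {u v : V} :
    (M.residual f).Pos u v ↔ M.E u v ∧ f u v < M.c u v :=
  and_congr_right' sub_pos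

theorem Network.residual_zero_pos : (M.residual fun _ _ => 0).Pos = M.Pos := by
  ext u v
  exact residual_pos_iff

/-- The flow `f` augmented by `Δ` units along the path `p 0, …, p l`. -/
noncomputable def augmentAlong (f : V → V → ℤ) (p : ℕ → V) (l : ℕ) (Δ : ℤ) (u v : V) : ℤ :=
  f u v + Δ * pathFlow p l u v

/-- A simple path from `X` to `Y` along which the flow `f` can be augmented by `Δ > 0` units; the
amount `Δ` need not be the largest one. -/
structure AugmentingPath (M : Network V) (X Y : Set V) (f : V → V → ℤ) (p : ℕ → V) (l : ℕ)
    (Δ : ℤ) : Prop where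
  injOn : Set.InjOn p (Set.Iic l)
  first_mem : p 0 ∈ X
  last_mem : p l ∈ Y
  path : ∀ i < l, (M.residual f).Pos (p i) (p (i + 1))
  amount_pos : 0 < Δ
  le_excess : Δ ≤ (M.residual f).e (p 0)
  le_cap : ∀ i < l, Δ ≤ (M.residual f).c (p i) (p (i + 1))

theorem AugmentStep.exists_augmentingPath {f' : V → V → ℤ} (h : AugmentStep M X Y f f') :
    ∃ p l Δ, AugmentingPath M X Y f p l Δ ∧ f' = augmentAlong f p l Δ := by
  obtain ⟨l, p, Δ, hp, hX, hY, he, hpath, ⟨hmem, hle⟩, hf'⟩ := h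
  refine ⟨p, l, Δ, ⟨hp, hX, hY, hpath, ?_, hle (.inl rfl), ?_⟩, hf'⟩
  swap
  · exact fun i hi => hle (.inr ⟨i, hi, rfl⟩)
  rcases hmem with rfl | ⟨i, hi, rfl⟩
  · exact he
  · exact (hpath i hi).2

theorem exists_augmentStep {x : V} (hx : x ∈ X) (he : 0 < (M.residual f).e x)
    (hr : (M.residual f).Reaches x Y) : ∃ f', AugmentStep M X Y f f' := by
  obtain ⟨y, hy, hxy⟩ := hr
  obtain ⟨l, p, hp, rfl, rfl, hpath⟩ := exists_injOn_path_of_reflTransGen hxy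
  set amounts : Set ℤ := {(M.residual f).e (p 0)} ∪
    {z | ∃ i < l, z = (M.residual f).c (p i) (p (i + 1))}
  have hfin : amounts.Finite := by
    refine (Set.finite_singleton _).union (((Set.finite_Iio l).image
      fun i => (M.residual f).c (p i) (p (i + 1))).subset ?_)
    rintro z ⟨i, hi, rfl⟩
    exact ⟨i, hi, rfl⟩
  obtain ⟨Δ, hΔ⟩ := hfin.exists_minimal ⟨_, .inl rfl⟩
  exact ⟨_, l, p, Δ, hp, hx, hy, he, hpath,
    ⟨hΔ.1, fun z hz => (le_total Δ z).elim id (hΔ.2 hz)⟩, rfl⟩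

namespace AugmentingPath

variable {p : ℕ → V} {l : ℕ} {Δ : ℤ}

theorem edge_of_pathFlow_ne_zero (hP : AugmentingPath M X Y f p l Δ) {u v : V}
    (huv : pathFlow p l u v ≠ 0) : M.E u v := by
  rcases lt_or_gt_of_ne huv with h | h
  · obtain ⟨i, hi, rfl, rfl⟩ := exists_edge_of_pathFlow_neg h
    exact M.symm _ _ (hP.path i hi).1
  · obtain ⟨i, hi, rfl, rfl⟩ := exists_edge_of_pathFlow_pos h
    exact (hP.path i hi).1

theorem isFlow_augmentAlong (hP : AugmentingPath M X Y f p l Δ) (hf : IsFlow M f) :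
    IsFlow M (augmentAlong f p l Δ) where
  antisymm u v := by
    simp only [augmentAlong]
    rw [hf.antisymm u v, pathFlow_antisymm u v]
    ring
  support u v huv := by
    have h0 : pathFlow p l u v = 0 := by_contra fun h => huv (hP.edge_of_pathFlow_ne_zero h)
    simp only [augmentAlong, hf.support u v huv, h0, mul_zero, add_zero]
  capacity u v huv := by
    have hΔ := hP.amount_pos
    simp only [augmentAlong]
    by_cases h : 0 < pathFlow p l u v
    · obtain ⟨i, hi, rfl, rfl⟩ := exists_edge_of_pathFlow_pos h
      have hcap : Δ ≤ M.c (p i) (p (i + 1)) - f (p i) (p (i + 1)) := hP.le_cap i hi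
      nlinarith [pathFlow_le_one (p := p) (l := l) (p i) (p (i + 1))]
    · nlinarith [hf.capacity u v huv]

open Classical in
theorem inflow_augmentAlong_of_ne_last (hP : AugmentingPath M X Y f p l Δ) {v : V}
    (hv : v ≠ p l) :
    inflow (augmentAlong f p l Δ) v = inflow f v - if v = p 0 then Δ else 0 := by
  have hsum : inflow (augmentAlong f p l Δ) v = inflow f v + Δ * inflow (pathFlow p l) v := by
    simp only [inflow, augmentAlong, Finset.sum_add_distrib, Finset.mul_sum]
  rw [hsum, inflow_pathFlow hP.injOn, if_neg hv.symm]
  simp only [eq_comm (a := v)]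
  split_ifs <;> ring

theorem inflow_augmentAlong_le (hP : AugmentingPath M X Y f p l Δ) {v : V} (hv : v ≠ p l) :
    inflow (augmentAlong f p l Δ) v ≤ inflow f v := by
  rw [hP.inflow_augmentAlong_of_ne_last hv]
  have := hP.amount_pos
  split_ifs <;> omega

theorem inflow_augmentAlong_first (hP : AugmentingPath M X Y f p l Δ) (h : p 0 ≠ p l) :
    inflow (augmentAlong f p l Δ) (p 0) = inflow f (p 0) - Δ := by
  rw [hP.inflow_augmentAlong_of_ne_last h, if_pos rfl]

theorem inflow_augmentAlong_of_ne (hP : AugmentingPath M X Y f p l Δ) {v : V} (h0 : v ≠ p 0)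
    (hl : v ≠ p l) : inflow (augmentAlong f p l Δ) v = inflow f v := by
  rw [hP.inflow_augmentAlong_of_ne_last hl, if_neg h0, sub_zero]

theorem residual_pos_or_reverse_edge (hP : AugmentingPath M X Y f p l Δ) {u v : V}
    (h : (M.residual (augmentAlong f p l Δ)).Pos u v) :
    (M.residual f).Pos u v ∨ ∃ i < l, p i = v ∧ p (i + 1) = u := by
  rw [Network.residual_pos_iff] at h ⊢
  rcases lt_or_ge (pathFlow p l u v) 0 with hneg | hnonneg
  · exact .inr (exists_edge_of_pathFlow_neg hneg)
  · exact .inl ⟨h.1, (le_add_of_nonneg_right (mul_nonneg hP.amount_pos.le hnonneg)).trans_lt h.2⟩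

/-- A path that uses the reversal of an edge of the augmenting path can be rerouted: towards `Y` it
follows the augmenting path from there on, and it shows that `p 0` reaches `T`. -/
theorem reaches_of_reaches_augmentAlong (hP : AugmentingPath M X Y f p l Δ) {T : Set V}
    (hT : Y ⊆ T ∨ ¬ (M.residual f).Reaches (p 0) T) {u : V}
    (h : (M.residual (augmentAlong f p l Δ)).Reaches u T) : (M.residual f).Reaches u T := by
  obtain ⟨y, hy, huy⟩ := h
  induction huy using Relation.ReflTransGen.head_induction_on with
  | refl => exact Network.reaches_of_mem hy
  | head hab _ ih =>
    rcases hP.residual_pos_or_reverse_edge hab with hab | ⟨i, hi, rfl, rfl⟩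
    · exact .head hab ih
    · rcases hT with hT | hT
      · exact .of_reflTransGen (reflTransGen_of_path (i := i + 1) hi hP.path)
          (Network.reaches_of_mem (hT hP.last_mem))
      · exact absurd (.of_reflTransGen (reflTransGen_of_path (Nat.zero_le i)
          fun n hn => hP.path n (hn.trans hi)) ih) hT

end AugmentingPath

theorem augmentTerminates_of_disjoint (hXY : Disjoint X Y) (hf : IsFlow M f) :
    AugmentTerminates M X Y f := by
  classical
  induction hn : ∑ v with v ∈ X, ((M.residual f).e v).toNat using Nat.strong_induction_on
    generalizing f with
  | _ n ih =>
    refine Acc.intro _ fun f' hs => ?_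
    obtain ⟨p, l, Δ, hP, rfl⟩ := hs.exists_augmentingPath
    have hf' := hP.isFlow_augmentAlong hf
    refine ih _ ?_ hf' rfl
    have hne : ∀ v ∈ X, v ≠ p l := fun v hv => hXY.ne_of_mem hv hP.last_mem
    have hΔ := hP.amount_pos
    have hle := hP.le_excess
    rw [← hn]
    refine Finset.sum_lt_sum (fun v hv => ?_) ⟨p 0, by simpa using hP.first_mem, ?_⟩
    · have := hP.inflow_augmentAlong_le (hne v (by simpa using hv))
      rw [hf.residual_e, hf'.residual_e]
      omega
    · have := hP.inflow_augmentAlong_first (hne _ hP.first_mem)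
      rw [hf.residual_e] at hle
      rw [hf.residual_e, hf'.residual_e]
      omega

theorem AugmentTerminates.exists_augment (h : AugmentTerminates M X Y f) :
    ∃ f', Augment M X Y f f' := by
  induction h with
  | intro f _ ih =>
    by_cases hs : ∃ f', AugmentStep M X Y f f'
    · obtain ⟨f', hs⟩ := hs
      obtain ⟨g, hg, hfinal⟩ := ih f' hs
      exact ⟨g, hg.head hs, hfinal⟩
    · exact ⟨f, .refl, hs⟩

end Flow

section Region

variable {N : Network V} {A : Set V} {D j k : ℕ} {d : V → ℕ} {u v : V}

namespace Network

theorem region_E_of_mem_right (hv : v ∈ A) : (N.region A).E u v ↔ N.E u v := by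
  refine ⟨And.left, fun h => ⟨h, ?_⟩⟩
  by_cases hu : u ∈ A ∪ {N.s, N.t}
  · exact .inl ⟨hu, .inl hv⟩
  · simp only [Set.mem_union, Set.mem_insert_iff, Set.mem_singleton_iff, not_or] at hu
    exact .inr (.inr ⟨⟨⟨v, hv, N.symm _ _ h⟩, hu⟩, hv⟩)

theorem region_E_of_mem_left (hu : u ∈ A) : (N.region A).E u v ↔ N.E u v :=
  ⟨And.left, fun h => (N.region A).symm _ _ ((region_E_of_mem_right hu).2 (N.symm _ _ h))⟩

theorem region_c_of_notMem_bdry (hu : u ∉ N.bdry A) : (N.region A).c u v = N.c u v :=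
  if_neg fun h => hu h.1

theorem region_e_of_mem (hv : v ∈ A) : (N.region A).e v = N.e v :=
  if_pos (.inl hv)

theorem region_pos_of_mem (hu : u ∈ A) : (N.region A).Pos u v ↔ N.Pos u v := by
  rw [Pos, Pos, region_E_of_mem_left hu, region_c_of_notMem_bdry fun h => h.2.1 hu]

theorem residual_region_pos_iff [Fintype V] {f f' : V → V → ℤ} (hu : u ∈ A) (h : f' u v = f u v) :
    (N.residual f').Pos u v ↔ ((N.region A).residual f).Pos u v := by
  rw [residual_pos_iff, residual_pos_iff, region_E_of_mem_left hu,
    region_c_of_notMem_bdry fun hu' => hu'.2.1 hu, h]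

theorem not_region_pos_of_notMem (hu : u ∉ A) (hs : u ≠ N.s) (ht : u ≠ N.t) :
    ¬ (N.region A).Pos u v := by
  rintro ⟨⟨-, ⟨hu' | rfl | rfl, -⟩ | ⟨hu', -⟩ | huv⟩, hc⟩
  · exact hu hu'
  · exact hs rfl
  · exact ht rfl
  · exact hu hu'
  · simp only [region, if_pos huv, lt_self_iff_false] at hc

/-- All edges out of the source are saturated, as they are throughout the algorithm. -/
def SourceSaturated (N : Network V) : Prop := ∀ v, v ≠ N.s → N.E N.s v → N.c N.s v = 0

theorem SourceSaturated.not_region_pos (h : N.SourceSaturated) (hv : v ≠ N.s) :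
    ¬ (N.region A).Pos N.s v := by
  rintro ⟨hE, hc⟩
  rw [region_c_of_notMem_bdry fun hs => hs.2.2.1 rfl, h v hv hE.1] at hc
  exact hc.false

theorem Nonneg.region_c_nonneg (hN : N.Nonneg) (h : N.E u v) : 0 ≤ (N.region A).c u v := by
  simp only [region]
  split_ifs
  · exact le_rfl
  · exact hN.1 u v h

/-- The edges of positive capacity inside the region `A`. -/
def PosWithin (N : Network V) (A : Set V) (u v : V) : Prop := u ∈ A ∧ v ∈ A ∧ N.Pos u v

end Network

theorem IsFlow.of_region (hN : N.Nonneg) {f : V → V → ℤ} (hf : IsFlow (N.region A) f) :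
    IsFlow N f where
  antisymm := hf.antisymm
  support u v h := hf.support u v fun h' => h h'.1
  capacity u v h := by
    by_cases hE : (N.region A).E u v
    · refine (hf.capacity u v hE).trans ?_
      simp only [Network.region]
      split_ifs
      · exact hN.1 u v h
      · exact le_rfl
    · exact (hf.support u v hE).trans_le (hN.1 u v h)

theorem target_mono (h : j ≤ k) : target N A d j ⊆ target N A d k :=
  Set.union_subset_union_right _ fun _ hv => ⟨hv.1, hv.2.trans_le h⟩

theorem disjoint_target (ht : N.t ∉ A) : Disjoint A (target N A d k) := by
  refine Set.disjoint_left.2 ?_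
  rintro v hv (rfl | hv')
  · exact ht hv
  · exact hv'.1.2.1 hv

theorem source_notMem_target : N.s ∉ target N A d k := by
  rintro (h | h)
  · exact N.s_ne_t h
  · exact h.1.2.2.1 rfl

theorem Network.Reaches.exists_exit (hN : N.SourceSaturated) (hs : N.s ∉ A) (ht : N.t ∉ A)
    {z : V} (hz : z ∈ A) (hr : (N.region A).Reaches z (target N A d k)) :
    ∃ u ∈ A, Relation.ReflTransGen (N.PosWithin A) z u ∧ ∃ w ∈ target N A d k, N.Pos u w := by
  obtain ⟨y, hy, hzy⟩ := hr
  suffices h : z ∈ target N A d k ∨ z ∈ A ∧ ∃ u ∈ A,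
      Relation.ReflTransGen (N.PosWithin A) z u ∧ ∃ w ∈ target N A d k, N.Pos u w from
    (h.resolve_left ((disjoint_target ht).notMem_of_mem_left hz)).2
  clear hz
  induction hzy using Relation.ReflTransGen.head_induction_on with
  | refl => exact .inl hy
  | @head a b hab _ ih =>
    have hbs : b ≠ N.s := by
      rintro rfl
      exact ih.elim source_notMem_target fun h => hs h.1
    by_cases ha : a ∈ A
    · rw [Network.region_pos_of_mem ha] at hab
      rcases ih with hb | ⟨hb, u, hu, hbu, hexit⟩
      · exact .inr ⟨ha, a, ha, .refl, b, hb, hab⟩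
      · exact .inr ⟨ha, u, hu, hbu.head ⟨ha, hb, hab⟩, hexit⟩
    · rcases eq_or_ne a N.t with rfl | hat
      · exact .inl (.inl rfl)
      rcases eq_or_ne a N.s with rfl | has
      · exact absurd hab (hN.not_region_pos hbs)
      · exact absurd hab (Network.not_region_pos_of_notMem ha has hat)

/-- The labeling `d` is valid on the region network of `A`, with maximal label `D`: edges inside the
region have length `0`, edges to the boundary have length `1`, and `d` is a lower bound for the
distance to the sink. -/
structure IsValidLabeling (N : Network V) (A : Set V) (D : ℕ) (d : V → ℕ) : Prop where
  le_max : ∀ v ∈ A, d v ≤ D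
  inner : ∀ u ∈ A, ∀ v ∈ A, N.Pos u v → d u ≤ d v
  outer : ∀ u ∈ A, ∀ v ∈ N.bdry A, N.Pos u v → d u ≤ d v + 1
  sink : ∀ u ∈ A, N.Pos u N.t → d u = 0

namespace IsValidLabeling

theorem le_of_reflTransGen (h : IsValidLabeling N A D d)
    (huv : Relation.ReflTransGen (N.PosWithin A) u v) : d u ≤ d v := by
  induction huv with
  | refl => exact le_rfl
  | tail _ hbc ih => exact ih.trans (h.inner _ hbc.1 _ hbc.2.1 hbc.2.2)

theorem le_of_pos_target (h : IsValidLabeling N A D d) (hu : u ∈ A) (hv : v ∈ target N A d k)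
    (huv : N.Pos u v) : d u ≤ k := by
  rcases hv with rfl | ⟨hv, hvk⟩
  · exact (h.sink u hu huv).trans_le k.zero_le
  · exact (h.outer u hu v hv huv).trans hvk

theorem le_of_reaches (h : IsValidLabeling N A D d) (hN : N.SourceSaturated) (hs : N.s ∉ A)
    (ht : N.t ∉ A) (hu : u ∈ A) (hr : (N.region A).Reaches u (target N A d k)) : d u ≤ k := by
  obtain ⟨v, hv, huv, w, hw, hvw⟩ := hr.exists_exit hN hs ht hu
  exact (h.le_of_reflTransGen huv).trans (h.le_of_pos_target hv hw hvw)

end IsValidLabeling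

end Region

section ARD

variable [Fintype V] {N : Network V} {A : Set V} {D j : ℕ} {d : V → ℕ} {f : V → V → ℤ}

/-- The invariant of the flow of ARD in stage `j`. The field `origin` records that a boundary vertex
`u` receives flow only in the stages after `d u`, from a vertex that by then cannot reach the target
set of stage `d u`. -/
structure StageInv (N : Network V) (A : Set V) (D : ℕ) (d : V → ℕ) (j : ℕ) (f : V → V → ℤ) :
    Prop where
  flow : IsFlow (N.region A) f
  inflow_source : inflow f N.s = 0
  excess_nonneg : ∀ v ∈ A, 0 ≤ N.e v + inflow f v
  inflow_nonpos : ∀ v ∈ A, inflow f v ≤ 0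
  reaches : ∀ k u, ((N.region A).residual f).Reaches u (target N A d k) →
    (N.region A).Reaches u (target N A d k)
  done : ∀ k < j, ∀ v ∈ A, 0 < N.e v + inflow f v →
    ¬ ((N.region A).residual f).Reaches v (target N A d k)
  origin : ∀ u ∈ N.bdry A, 0 < inflow f u → d u < D ∧ ∃ x ∈ A, 0 < N.e x ∧
    (N.region A).Reaches x (target N A d D) ∧
    ¬ ((N.region A).residual f).Reaches x (target N A d (d u))

theorem stageInv_zero (hN : N.Nonneg) (hs : N.s ∉ A) (ht : N.t ∉ A) :
    StageInv N A D d 0 (fun _ _ => 0) where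
  flow := ⟨by simp, by simp, fun u v huv => hN.region_c_nonneg huv.1⟩
  inflow_source := Finset.sum_const_zero
  excess_nonneg v hv := by
    simpa [inflow] using hN.2 v (ne_of_mem_of_not_mem hv hs) (ne_of_mem_of_not_mem hv ht)
  inflow_nonpos _ _ := Finset.sum_const_zero.le
  reaches k u := by simp only [Network.Reaches, Network.residual_zero_pos, imp_self]
  done := by simp
  origin := by simp [inflow]

namespace StageInv

theorem residual_e (hf : StageInv N A D d j f) {v : V} (hv : v ∈ A) :
    ((N.region A).residual f).e v = N.e v + inflow f v := by
  rw [hf.flow.residual_e, Network.region_e_of_mem hv]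

section AugmentAlong

variable {p : ℕ → V} {l : ℕ} {Δ : ℤ}

theorem excess_first_pos (hf : StageInv N A D d j f)
    (hP : AugmentingPath (N.region A) A (target N A d j) f p l Δ) :
    0 < N.e (p 0) + inflow f (p 0) := by
  have := hP.amount_pos.trans_le hP.le_excess
  rwa [hf.residual_e hP.first_mem] at this

theorem reaches_of_augmentAlong (hf : StageInv N A D d j f)
    (hP : AugmentingPath (N.region A) A (target N A d j) f p l Δ) {k : ℕ} {u : V}
    (h : ((N.region A).residual (augmentAlong f p l Δ)).Reaches u (target N A d k)) :
    ((N.region A).residual f).Reaches u (target N A d k) := by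
  refine hP.reaches_of_reaches_augmentAlong ?_ h
  rcases le_or_gt j k with hk | hk
  · exact .inl (target_mono hk)
  · exact .inr (hf.done k hk _ hP.first_mem (hf.excess_first_pos hP))

theorem origin_augmentAlong (hf : StageInv N A D d j f) (hj : j ≤ D)
    (hP : AugmentingPath (N.region A) A (target N A d j) f p l Δ) {u : V} (hu : u ∈ N.bdry A)
    (hpos : 0 < inflow (augmentAlong f p l Δ) u) :
    d u < D ∧ ∃ x ∈ A, 0 < N.e x ∧ (N.region A).Reaches x (target N A d D) ∧
      ¬ ((N.region A).residual (augmentAlong f p l Δ)).Reaches x (target N A d (d u)) := by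
  by_cases hold : 0 < inflow f u
  · obtain ⟨hdu, x, hx, hex, hreach, hnot⟩ := hf.origin u hu hold
    exact ⟨hdu, x, hx, hex, hreach, mt (hf.reaches_of_augmentAlong hP) hnot⟩
  have hfirst : p 0 ∈ A := hP.first_mem
  obtain rfl : u = p l := by
    by_contra hul
    exact hold (hpos.trans_le (hP.inflow_augmentAlong_le hul))
  have hdu : d (p l) < j := (hP.last_mem.resolve_left hu.2.2.2).2
  refine ⟨hdu.trans_le hj, p 0, hfirst, ?_, ?_, ?_⟩
  · linarith [hf.inflow_nonpos _ hfirst, hf.excess_first_pos hP]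
  · exact hf.reaches _ _ ⟨p l, target_mono hj hP.last_mem, reflTransGen_of_path l.zero_le hP.path⟩
  · exact mt (hf.reaches_of_augmentAlong hP) (hf.done _ hdu _ hfirst (hf.excess_first_pos hP))

protected theorem augmentAlong (hf : StageInv N A D d j f) (hs : N.s ∉ A) (ht : N.t ∉ A)
    (hj : j ≤ D) (hP : AugmentingPath (N.region A) A (target N A d j) f p l Δ) :
    StageInv N A D d j (augmentAlong f p l Δ) := by
  have hne : ∀ v ∈ A, v ≠ p l := fun v hv => (disjoint_target ht).ne_of_mem hv hP.last_mem
  have hle : ∀ v ∈ A, inflow (augmentAlong f p l Δ) v ≤ inflow f v := fun v hv =>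
    hP.inflow_augmentAlong_le (hne v hv)
  exact
    { flow := hP.isFlow_augmentAlong hf.flow
      inflow_source := by
        rw [hP.inflow_augmentAlong_of_ne (ne_of_mem_of_not_mem hP.first_mem hs).symm
          (ne_of_mem_of_not_mem hP.last_mem source_notMem_target).symm, hf.inflow_source]
      excess_nonneg v hv := by
        rcases eq_or_ne v (p 0) with rfl | hv0
        · have hamount := hP.le_excess
          rw [hf.residual_e hv] at hamount
          rw [hP.inflow_augmentAlong_first (hne _ hv)]
          linarith
        · rw [hP.inflow_augmentAlong_of_ne hv0 (hne v hv)]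
          exact hf.excess_nonneg v hv
      inflow_nonpos v hv := (hle v hv).trans (hf.inflow_nonpos v hv)
      reaches k u h := hf.reaches k u (hf.reaches_of_augmentAlong hP h)
      done k hk v hv he h :=
        hf.done k hk v hv (he.trans_le (add_le_add_right (hle v hv) _))
          (hf.reaches_of_augmentAlong hP h)
      origin _ hu hpos := hf.origin_augmentAlong hj hP hu hpos }

end AugmentAlong

theorem of_augment (hf : StageInv N A D d j f) (hs : N.s ∉ A) (ht : N.t ∉ A) (hj : j ≤ D)
    {f' : V → V → ℤ} (ha : Augment (N.region A) A (target N A d j) f f') :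
    StageInv N A D d (j + 1) f' := by
  obtain ⟨hsteps, hfinal⟩ := ha
  have hf' : StageInv N A D d j f' := by
    clear hfinal
    induction hsteps with
    | refl => exact hf
    | tail _ hstep ih =>
      obtain ⟨p, l, Δ, hP, rfl⟩ := hstep.exists_augmentingPath
      exact ih.augmentAlong hs ht hj hP
  refine { hf' with done := fun k hk v hv he hreach => ?_ }
  rcases Nat.lt_succ_iff_lt_or_eq.1 hk with hk | rfl
  · exact hf'.done k hk v hv he hreach
  · exact hfinal (exists_augmentStep hv (by rwa [hf'.residual_e hv]) hreach)

end StageInv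

theorem ARDStages.stageInv (h : ARDStages N A d j f) (hN : N.Nonneg) (hs : N.s ∉ A)
    (ht : N.t ∉ A) (hj : j ≤ D + 1) : StageInv N A D d j f := by
  induction h with
  | zero => exact stageInv_zero hN hs ht
  | succ _ ha ih => exact (ih (by omega)).of_augment hs ht (by omega) ha

theorem exists_ardStages (hN : N.Nonneg) (hs : N.s ∉ A) (ht : N.t ∉ A) (j : ℕ) :
    ∃ f, ARDStages N A d j f := by
  induction j with
  | zero => exact ⟨_, .zero⟩
  | succ j ih =>
    obtain ⟨f, hf⟩ := ih
    obtain ⟨f', hf'⟩ := (augmentTerminates_of_disjoint (disjoint_target ht)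
      (hf.stageInv (D := j) hN hs ht (by omega)).flow).exists_augment
    exact ⟨f', hf.succ hf'⟩

theorem regionRelabel_le_iff {u : V} (hu : u ∈ A) {k : ℕ} :
    regionRelabel N A D d f u ≤ k ↔
      D ≤ k ∨ ((N.region A).residual f).Reaches u (target N A d k) := by
  simp only [regionRelabel, if_pos hu]
  split_ifs with hD
  · set S := {k | ((N.region A).residual f).Reaches u (target N A d k)}
    have hmem : sInf S ∈ S := Nat.sInf_mem ⟨D, hD⟩
    refine ⟨fun h => .inr (hmem.mono (target_mono h)), ?_⟩
    rintro (h | h)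
    · exact (Nat.sInf_le hD).trans h
    · exact Nat.sInf_le h
  · refine ⟨.inl, fun h => h.elim id fun h => ?_⟩
    by_contra hk
    exact hD (h.mono (target_mono (not_le.1 hk).le))

/-- What the analysis of the algorithm uses about the output `(f, d')` of ARD. -/
structure ARDSpec (N : Network V) (A : Set V) (D : ℕ) (d : V → ℕ) (f : V → V → ℤ) (d' : V → ℕ) :
    Prop where
  flow : IsFlow (N.region A) f
  source : ∀ v, f v N.s = 0
  excess_nonneg : ∀ v ∈ A, 0 ≤ N.e v + inflow f v
  of_excess_pos : ∀ v ∈ A, 0 < N.e v + inflow f v →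
    d' v = D ∧ ¬ ((N.region A).residual f).Reaches v (target N A d D)
  le : ∀ v ∈ A, d v ≤ d' v
  le_max : ∀ v ∈ A, d' v ≤ D
  inner : ∀ u ∈ A, ∀ v ∈ A, ((N.region A).residual f).Pos u v → d' u ≤ d' v
  outer : ∀ u ∈ A, ∀ v ∈ N.bdry A, ((N.region A).residual f).Pos u v → d' u ≤ d v + 1
  sink : ∀ u ∈ A, ((N.region A).residual f).Pos u N.t → d' u = 0
  origin : ∀ u ∈ N.bdry A, ∀ w, 0 < f w u → d u < D ∧ ∃ x ∈ A, 0 < N.e x ∧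
    (N.region A).Reaches x (target N A d D) ∧ d u < d' x

theorem ARDStages.spec {d' : V → ℕ} (h : ARDStages N A d (D + 1) f)
    (hd' : ∀ v ∈ A, d' v = regionRelabel N A D d f v) (hN : N.Nonneg) (hsat : N.SourceSaturated)
    (hs : N.s ∉ A) (ht : N.t ∉ A) (hd : IsValidLabeling N A D d) : ARDSpec N A D d f d' := by
  have hf := h.stageInv hN hs ht le_rfl
  have le_iff : ∀ u ∈ A, ∀ k, d' u ≤ k ↔
      D ≤ k ∨ ((N.region A).residual f).Reaches u (target N A d k) := fun u hu k => by
    rw [hd' u hu, regionRelabel_le_iff hu]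
  have hsource : ∀ w, 0 ≤ f w N.s := fun w => by
    rcases eq_or_ne w N.s with rfl | hw
    · linarith [hf.flow.antisymm N.s N.s]
    · exact hf.flow.nonneg_of_not_pos (hsat.not_region_pos hw)
  exact
    { flow := hf.flow
      source v := (Finset.sum_eq_zero_iff_of_nonneg fun w _ => hsource w).1 hf.inflow_source v
        (Finset.mem_univ v)
      excess_nonneg := hf.excess_nonneg
      of_excess_pos v hv he := by
        have hnot := hf.done D D.lt_succ_self v hv he
        exact ⟨by rw [hd' v hv, regionRelabel, if_pos hv, if_neg hnot], hnot⟩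
      le v hv := ((le_iff v hv _).1 le_rfl).elim (hd.le_max v hv).trans fun hr =>
        hd.le_of_reaches hsat hs ht hv (hf.reaches _ _ hr)
      le_max v hv := (le_iff v hv D).2 (.inl le_rfl)
      inner u hu v hv huv := (le_iff u hu _).2 (((le_iff v hv _).1 le_rfl).imp_right (.head huv))
      outer u hu v hv huv := (le_iff u hu _).2
        (.inr (.head huv (Network.reaches_of_mem (.inr ⟨hv, (d v).lt_succ_self⟩))))
      sink u hu huv := Nat.le_zero.1 <| (le_iff u hu _).2
        (.inr (.head huv (Network.reaches_of_mem (.inl rfl))))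
      origin u hu w hw := by
        have hnonneg : ∀ w, 0 ≤ f w u := fun w => hf.flow.nonneg_of_not_pos
          (Network.not_region_pos_of_notMem hu.2.1 hu.2.2.1 hu.2.2.2)
        obtain ⟨hdu, x, hx, hex, hreach, hnot⟩ := hf.origin u hu
          (hw.trans_le (Finset.single_le_sum (fun w _ => hnonneg w) (Finset.mem_univ w)))
        refine ⟨hdu, x, hx, hex, hreach, ?_⟩
        rw [← not_le, le_iff x hx, not_or]
        exact ⟨hdu.not_ge, hnot⟩ }

end ARD

section Fusion

variable {N : Network V} {K : ℕ} {R : Fin K → Set V} {D : ℕ} {d d' : V → ℕ} {u v : V} {j k : Fin K}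

namespace IsRegionPartition

theorem source_notMem (hR : IsRegionPartition N R) (k : Fin K) : N.s ∉ R k :=
  fun h => ((hR.2 _).1 ⟨k, h⟩).1 rfl

theorem sink_notMem (hR : IsRegionPartition N R) (k : Fin K) : N.t ∉ R k :=
  fun h => ((hR.2 _).1 ⟨k, h⟩).2 rfl

theorem terminal_or_mem (hR : IsRegionPartition N R) (v : V) :
    (v = N.s ∨ v = N.t) ∨ ∃ k, v ∈ R k :=
  or_iff_not_imp_left.2 fun h => (hR.2 v).2 (not_or.1 h)

theorem notMem_of_ne (hR : IsRegionPartition N R) (hjk : j ≠ k) (hv : v ∈ R j) : v ∉ R k :=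
  (hR.1 j k hjk).notMem_of_mem_left hv

theorem mem_bdry_of_ne (hR : IsRegionPartition N R) (hjk : j ≠ k) (hu : u ∈ R j) (hv : v ∈ R k)
    (h : N.E u v) : v ∈ N.bdry (R j) :=
  ⟨⟨u, hu, h⟩, hR.notMem_of_ne hjk.symm hv, (hR.2 v).1 ⟨k, hv⟩⟩

theorem exists_mem_of_mem_bdry (hR : IsRegionPartition N R) (hv : v ∈ N.bdry (R k)) :
    ∃ j, j ≠ k ∧ v ∈ R j :=
  let ⟨j, hj⟩ := (hR.2 v).2 hv.2.2
  ⟨j, fun h => hv.2.1 (h ▸ hj), hj⟩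

theorem exists_mem_of_mem_boundary (hR : IsRegionPartition N R) (hv : v ∈ boundary N R) :
    ∃ k, v ∈ R k :=
  let ⟨_, hk⟩ := Set.mem_iUnion.1 hv
  (hR.2 v).2 hk.2.2

end IsRegionPartition

theorem mem_boundary_of_mem_bdry (h : v ∈ N.bdry (R k)) : v ∈ boundary N R :=
  Set.mem_iUnion.2 ⟨k, h⟩

variable [Fintype V]

/-- The situation in a sweep after the fusion: `fk k` is the flow that ARD returns for the region
`R k`, and `f'` and `d'` are the fused flow and the fused labels. -/
structure Fusion (N : Network V) (R : Fin K → Set V) (D : ℕ) (d : V → ℕ) (fk : Fin K → V → V → ℤ)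
    (f' : V → V → ℤ) (d' : V → ℕ) : Prop where
  part : IsRegionPartition N R
  nonneg : N.Nonneg
  saturated : N.SourceSaturated
  spec : ∀ k, ARDSpec N (R k) D d (fk k) d'
  flow : FusedFlow N R d' fk f'

namespace Fusion

variable {fk : Fin K → V → V → ℤ} {f' : V → V → ℤ}

theorem isFlow_region (H : Fusion N R D d fk f' d') (k : Fin K) : IsFlow N (fk k) :=
  (H.spec k).flow.of_region H.nonneg

theorem nonneg_of_ne (H : Fusion N R D d fk f' d') (hjk : j ≠ k) (hv : v ∈ R k) :
    0 ≤ fk j u v := by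
  obtain ⟨hs, ht⟩ := (H.part.2 v).1 ⟨k, hv⟩
  exact (H.spec j).flow.nonneg_of_not_pos
    (Network.not_region_pos_of_notMem (H.part.notMem_of_ne hjk.symm hv) hs ht)

theorem nonpos_of_ne (H : Fusion N R D d fk f' d') (hjk : j ≠ k) (hu : u ∈ R k) :
    fk j u v ≤ 0 := by
  rw [(H.spec j).flow.antisymm, neg_nonpos]
  exact H.nonneg_of_ne hjk hu

theorem flow_eq (H : Fusion N R D d fk f' d') (hv : v ∈ R k) (hu : u ∈ R k ∨ u = N.s ∨ u = N.t) :
    f' u v = fk k u v ∧ f' v u = fk k v u := by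
  rcases hu with hu | hu
  · exact ⟨H.flow.2.1 k u hu v hv, H.flow.2.1 k v hv u hu⟩
  · exact (H.flow.2.2.1 k v hv u hu).symm

theorem flow_eq_of_ne (H : Fusion N R D d fk f' d') (hjk : j ≠ k) (hu : u ∈ R j) (hv : v ∈ R k) :
    f' u v = validPair d' v u * fk j u v + validPair d' u v * fk k u v :=
  H.flow.1 j k hjk u hu v hv

theorem flow_eq_or_exists_ne (H : Fusion N R D d fk f' d') (hv : v ∈ R k) (u : V) :
    (f' u v = fk k u v ∧ f' v u = fk k v u) ∨ ∃ j, j ≠ k ∧ u ∈ R j := by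
  rcases H.part.terminal_or_mem u with hu | ⟨j, hj⟩
  · exact .inl (H.flow_eq hv (.inr hu))
  · rcases eq_or_ne j k with rfl | hjk
    · exact .inl (H.flow_eq hv (.inl hj))
    · exact .inr ⟨j, hjk, hj⟩

theorem flow_cases (H : Fusion N R D d fk f' d') (u v : V) :
    (f' u v = 0 ∧ f' v u = 0) ∨ (∃ k, f' u v = fk k u v ∧ f' v u = fk k v u) ∨
      ∃ j k, j ≠ k ∧ u ∈ R j ∧ v ∈ R k := by
  rcases H.part.terminal_or_mem v with hv | ⟨k, hv⟩
  · rcases H.part.terminal_or_mem u with hu | ⟨j, hu⟩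
    · exact .inl ⟨H.flow.2.2.2 u v hu hv, H.flow.2.2.2 v u hv hu⟩
    · exact .inr (.inl ⟨j, (H.flow_eq hu (.inr hv)).symm⟩)
  · rcases H.flow_eq_or_exists_ne hv u with h | ⟨j, hjk, hu⟩
    · exact .inr (.inl ⟨k, h⟩)
    · exact .inr (.inr ⟨j, k, hjk, hu, hv⟩)

theorem isFlow (H : Fusion N R D d fk f' d') : IsFlow N f' where
  antisymm u v := by
    rcases H.flow_cases u v with ⟨huv, hvu⟩ | ⟨k, huv, hvu⟩ | ⟨j, k, hjk, hu, hv⟩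
    · rw [huv, hvu, neg_zero]
    · rw [huv, hvu, (H.isFlow_region k).antisymm]
    · rw [H.flow_eq_of_ne hjk hu hv, H.flow_eq_of_ne hjk.symm hv hu,
        (H.isFlow_region j).antisymm u v, (H.isFlow_region k).antisymm u v]
      ring
  support u v hE := by
    rcases H.flow_cases u v with ⟨huv, -⟩ | ⟨k, huv, -⟩ | ⟨j, k, hjk, hu, hv⟩
    · exact huv
    · rw [huv, (H.isFlow_region k).support u v hE]
    · rw [H.flow_eq_of_ne hjk hu hv, (H.isFlow_region j).support u v hE,
        (H.isFlow_region k).support u v hE, mul_zero, mul_zero, add_zero]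
  capacity u v hE := by
    have hc := H.nonneg.1 u v hE
    rcases H.flow_cases u v with ⟨huv, -⟩ | ⟨k, huv, -⟩ | ⟨j, k, hjk, hu, hv⟩
    · rwa [huv]
    · exact huv.trans_le ((H.isFlow_region k).capacity u v hE)
    · have hcap := (H.isFlow_region j).capacity u v hE
      have hnonpos : fk k u v ≤ 0 := H.nonpos_of_ne hjk.symm hu
      rw [H.flow_eq_of_ne hjk hu hv, validPair, validPair]
      split_ifs <;> omega

theorem le_flow (H : Fusion N R D d fk f' d') (hv : v ∈ R k) (u : V) : fk k u v ≤ f' u v := by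
  rcases H.flow_eq_or_exists_ne hv u with ⟨h, -⟩ | ⟨j, hjk, hu⟩
  · exact h.ge
  · have hnonneg : 0 ≤ fk j u v := H.nonneg_of_ne hjk hv
    have hnonpos : fk k u v ≤ 0 := H.nonpos_of_ne hjk.symm hu
    rw [H.flow_eq_of_ne hjk hu hv, validPair, validPair]
    split_ifs <;> omega

theorem exists_of_lt_flow (H : Fusion N R D d fk f' d') (hv : v ∈ R k) (h : fk k u v < f' u v) :
    ∃ j, j ≠ k ∧ u ∈ R j ∧ N.E u v ∧ (0 < fk j u v ∨ 0 < fk k v u ∧ d' v + 1 < d' u) := by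
  rcases H.flow_eq_or_exists_ne hv u with ⟨heq, -⟩ | ⟨j, hjk, hu⟩
  · exact absurd heq h.ne'
  have hE : N.E u v := by
    by_contra hE
    rw [H.isFlow.support u v hE, (H.isFlow_region k).support u v hE] at h
    exact h.false
  have hnonneg : 0 ≤ fk j u v := H.nonneg_of_ne hjk hv
  have hanti := (H.isFlow_region k).antisymm u v
  refine ⟨j, hjk, hu, hE, ?_⟩
  rw [H.flow_eq_of_ne hjk hu hv, validPair, validPair] at h
  split_ifs at h <;> omega

theorem excess_le (H : Fusion N R D d fk f' d') (hv : v ∈ R k) :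
    N.e v + inflow (fk k) v ≤ (N.residual f').e v := by
  rw [H.isFlow.residual_e]
  exact add_le_add_right (Finset.sum_le_sum fun u _ => H.le_flow hv u) _

theorem exists_of_excess_pos (H : Fusion N R D d fk f' d') (he : 0 < (N.residual f').e v)
    (k : Fin K) :
    0 < N.e v + inflow (fk k) v ∨ ∃ u, fk k u v < f' u v := by
  refine or_iff_not_imp_right.2 fun h => he.trans_le ?_
  rw [H.isFlow.residual_e]
  exact add_le_add_right (Finset.sum_le_sum fun u _ => not_lt.1 fun hu => h ⟨u, hu⟩) _

theorem residual_nonneg (H : Fusion N R D d fk f' d') : (N.residual f').Nonneg := by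
  refine ⟨fun u v hE => sub_nonneg.2 (H.isFlow.capacity u v hE), fun v hs ht => ?_⟩
  obtain ⟨k, hk⟩ := (H.part.2 v).2 ⟨hs, ht⟩
  exact ((H.spec k).excess_nonneg v hk).trans (H.excess_le hk)

theorem residual_sourceSaturated (H : Fusion N R D d fk f' d') :
    (N.residual f').SourceSaturated := by
  intro v hv hE
  have hflow : f' N.s v = 0 := by
    rcases H.part.terminal_or_mem v with ht | ⟨k, hk⟩
    · exact H.flow.2.2.2 _ _ (.inl rfl) ht
    · rw [(H.flow_eq hk (.inr (.inl rfl))).1, (H.spec k).flow.antisymm, (H.spec k).source, neg_zero]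
  exact (congrArg₂ (· - ·) (H.saturated v hv hE) hflow).trans (sub_zero 0)

theorem isValidLabeling (H : Fusion N R D d fk f' d') (k : Fin K) :
    IsValidLabeling (N.residual f') (R k) D d' where
  le_max := (H.spec k).le_max
  inner u hu v hv huv :=
    (H.spec k).inner u hu v hv <|
      (Network.residual_region_pos_iff hu (H.flow_eq hu (.inl hv)).2).1 huv
  outer u hu v hv huv := by
    obtain ⟨j, hjk, hj⟩ := H.part.exists_mem_of_mem_bdry hv
    by_contra hlt
    -- The edge `(u,v)` is invalid, hence the fused flow on it is that of the region of `u`.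
    have hflow : f' u v = fk k u v := by
      rw [H.flow_eq_of_ne hjk.symm hu hj, validPair, validPair, if_pos (by omega), if_neg hlt,
        one_mul, zero_mul, add_zero]
    have houter := (H.spec k).outer u hu v hv ((Network.residual_region_pos_iff hu hflow).1 huv)
    have hle := (H.spec j).le v hj
    omega
  sink u hu huv :=
    (H.spec k).sink u hu <|
      (Network.residual_region_pos_iff hu (H.flow_eq hu (.inr (.inr rfl))).2).1 huv

end Fusion

end Fusion

section GlobalGap

variable {N : Network V} {A : Set V} {D : ℕ} {d d' : V → ℕ}

namespace GlobalGap

theorem le (h : GlobalGap D d d') {v : V} (hv : d v ≤ D) : d v ≤ d' v := by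
  rcases h with rfl | ⟨g, -, -, rfl⟩
  · exact le_rfl
  · simp only
    split_ifs
    · exact hv
    · exact le_rfl

theorem le_max (h : GlobalGap D d d') {v : V} (hv : d v ≤ D) : d' v ≤ D := by
  rcases h with rfl | ⟨g, -, -, rfl⟩
  · exact hv
  · simp only
    split_ifs
    · exact le_rfl
    · exact hv

theorem le_add (h : GlobalGap D d d') {u v : V} {m : ℕ} (hm : m ≤ 1) (hu : d u ≤ D)
    (huv : d u ≤ d v + m) : d' u ≤ d' v + m := by
  rcases h with rfl | ⟨g, -, hg, rfl⟩
  · exact huv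
  · have := hg v
    simp only
    split_ifs <;> omega

theorem eq_zero (h : GlobalGap D d d') {v : V} (hv : d v = 0) : d' v = 0 := by
  rcases h with rfl | ⟨g, -, -, rfl⟩
  · exact hv
  · simp only [hv, not_lt_zero, if_false]

end GlobalGap

theorem IsValidLabeling.globalGap (h : IsValidLabeling N A D d) (hg : GlobalGap D d d') :
    IsValidLabeling N A D d' where
  le_max v hv := hg.le_max (h.le_max v hv)
  inner u hu v hv huv := hg.le_add zero_le_one (h.le_max u hu) (h.inner u hu v hv huv)
  outer u hu v hv huv := hg.le_add le_rfl (h.le_max u hu) (h.outer u hu v hv huv)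
  sink u hu huv := hg.eq_zero (h.sink u hu huv)

end GlobalGap

section Potential

open Classical in
/-- The sum of the labels `d` over `B`. -/
noncomputable def labelSum [Fintype V] (B : Set V) (d : V → ℕ) : ℕ := ∑ v with v ∈ B, d v

section LabelSum

variable [Fintype V] {B : Set V} {d d' : V → ℕ}

theorem labelSum_add_sum_le (h : ∀ v ∈ B, d v ≤ d' v) (s : Finset V) (hs : ↑s ⊆ B) :
    labelSum B d + ∑ v ∈ s, d' v ≤ labelSum B d' + ∑ v ∈ s, d v := by
  classical
  have hsub : s ⊆ Finset.univ.filter (· ∈ B) := fun v hv => by simpa using hs hv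
  simp only [labelSum]
  rw [← Finset.sum_sdiff hsub, ← Finset.sum_sdiff (f := d') hsub, add_right_comm]
  refine add_le_add_left (add_le_add_left (Finset.sum_le_sum fun v hv => h v ?_) _) _
  simpa using (Finset.mem_sdiff.1 hv).1

theorem labelSum_lt {D : ℕ} (h : ∀ v ∈ B, d v ≤ D) {v : V} (hv : v ∈ B) (hlt : d v < D) :
    labelSum B d < B.ncard * D := by
  classical
  rw [Set.ncard_eq_toFinset_card', ← smul_eq_mul, ← Finset.sum_const, labelSum,
    ← Set.filter_mem_univ_eq_toFinset]
  exact Finset.sum_lt_sum (by simpa using h) ⟨v, by simpa using hv, hlt⟩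

end LabelSum

/-- The vertices over which the potential takes the largest label: those of positive excess that are
active or reach the target set in the region network. The second alternative matters because ARD
stops with all labels of its vertices of positive excess equal to `D`, and only the fusion makes the
targets accessible again. -/
def Eligible {K : ℕ} (N : Network V) (R : Fin K → Set V) (D : ℕ) (d : V → ℕ) (x : V) : Prop :=
  ∃ k, x ∈ R k ∧ 0 < N.e x ∧ (d x < D ∨ (N.region (R k)).Reaches x (target N (R k) d D))

/-- All active vertices are boundary vertices, as is the case after every sweep. -/
def ActiveInBoundary {K : ℕ} (N : Network V) (R : Fin K → Set V) (D : ℕ) (d : V → ℕ) : Prop :=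
  ∀ k, ∀ x ∈ R k, 0 < N.e x → d x < D → x ∈ boundary N R

namespace Fusion

variable [Fintype V] {N : Network V} {K : ℕ} {R : Fin K → Set V} {D : ℕ} {d d' d'' : V → ℕ}
  {fk : Fin K → V → V → ℤ} {f' : V → V → ℤ} {u v w : V} {j k : Fin K}

theorem le_globalGap (H : Fusion N R D d fk f' d') (hg : GlobalGap D d' d'') (hv : v ∈ R k) :
    d v ≤ d'' v :=
  ((H.spec k).le v hv).trans (hg.le ((H.spec k).le_max v hv))

theorem activeInBoundary (H : Fusion N R D d fk f' d') (hg : GlobalGap D d' d'') :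
    ActiveInBoundary (N.residual f') R D d'' := by
  intro k v hv he hd
  have hlt : d' v < D := (hg.le ((H.spec k).le_max v hv)).trans_lt hd
  obtain h | ⟨u, hu⟩ := H.exists_of_excess_pos he k
  · exact absurd ((H.spec k).of_excess_pos v hv h).1 hlt.ne
  · obtain ⟨j, hjk, hj, hE, -⟩ := H.exists_of_lt_flow hv hu
    exact mem_boundary_of_mem_bdry (H.part.mem_bdry_of_ne hjk hj hv hE)

theorem region_residual_reflTransGen (H : Fusion N R D d fk f' d')
    (h : Relation.ReflTransGen ((N.residual f').PosWithin (R k)) v u) :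
    Relation.ReflTransGen ((N.region (R k)).residual (fk k)).Pos v u :=
  Relation.ReflTransGen.mono (fun _ _ hab =>
    (Network.residual_region_pos_iff hab.1 (H.flow_eq hab.1 (.inl hab.2.1)).2).1 hab.2.2) _ _ h

theorem exists_lt_flow_of_eligible (H : Fusion N R D d fk f' d') (hg : GlobalGap D d' d'')
    (hv : Eligible (N.residual f') R D d'' v) :
    ∃ k, ∃ u ∈ R k, d'' v ≤ d'' u ∧ ∃ w, fk k w u < f' w u := by
  obtain ⟨k, hk, he, hreach⟩ := hv
  obtain hown | ⟨w, hw⟩ := H.exists_of_excess_pos he k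
  swap
  · exact ⟨k, v, hk, le_rfl, w, hw⟩
  obtain ⟨hD, hnot⟩ := (H.spec k).of_excess_pos v hk hown
  have hge : D ≤ d'' v := hD.ge.trans (hg.le ((H.spec k).le_max v hk))
  obtain ⟨u, hu, hvu, w, hw, huw⟩ := (hreach.resolve_left hge.not_gt).exists_exit
    H.residual_sourceSaturated (H.part.source_notMem k) (H.part.sink_notMem k) hk
  refine ⟨k, u, hu, ((H.isValidLabeling k).globalGap hg).le_of_reflTransGen hvu, w,
    (H.le_flow hu w).lt_of_ne fun heq => hnot ?_⟩
  -- Without a surplus, the path to `w` would have been open when ARD stopped.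
  have hpos := (Network.residual_region_pos_iff (f := fk k) hu
    (by rw [H.isFlow.antisymm, ← heq, ← (H.isFlow_region k).antisymm])).1 huw
  have hw' : w ∈ target N (R k) d D := by
    rcases hw with hw | ⟨hw, hlt⟩
    · exact .inl hw
    · obtain ⟨j, -, hj⟩ := H.part.exists_mem_of_mem_bdry hw
      exact .inr ⟨hw, (H.le_globalGap hg hj).trans_lt hlt⟩
  exact ⟨w, hw', (H.region_residual_reflTransGen hvu).tail hpos⟩

theorem exists_inflow_of_lt_flow (H : Fusion N R D d fk f' d') (hg : GlobalGap D d' d'')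
    (hv : v ∈ R k) (h : fk k u v < f' u v) :
    ∃ j, ∃ z ∈ N.bdry (R j), d'' v ≤ d'' z ∧ ∃ w, 0 < fk j w z := by
  obtain ⟨j, hjk, hj, hE, hpos | ⟨hpos, hlt⟩⟩ := H.exists_of_lt_flow hv h
  · exact ⟨j, v, H.part.mem_bdry_of_ne hjk hj hv hE, le_rfl, u, hpos⟩
  · refine ⟨k, u, H.part.mem_bdry_of_ne hjk.symm hv hj (N.symm _ _ hE), ?_, v, hpos⟩
    exact hg.le_add zero_le_one ((H.spec k).le_max v hv) (by omega)

theorem exists_eligible_of_inflow (H : Fusion N R D d fk f' d') (hg : GlobalGap D d' d'')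
    (hact : ActiveInBoundary N R D d) (hu : u ∈ N.bdry (R k)) (hw : 0 < fk k w u) :
    ∃ x, Eligible N R D d x ∧
      d'' u + 1 + labelSum (boundary N R) d ≤ d x + labelSum (boundary N R) d'' := by
  classical
  obtain ⟨hdu, x, hx, hex, hreach, hux⟩ := (H.spec k).origin u hu w hw
  have hle : ∀ v ∈ boundary N R, d v ≤ d'' v := fun v hv =>
    let ⟨_, hj⟩ := H.part.exists_mem_of_mem_boundary hv
    H.le_globalGap hg hj
  have huB : u ∈ boundary N R := mem_boundary_of_mem_bdry hu
  refine ⟨x, ⟨k, hx, hex, .inr hreach⟩, ?_⟩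
  rcases lt_or_ge (d x) D with hxD | hxD
  · have hne : u ≠ x := (ne_of_mem_of_not_mem hx hu.2.1).symm
    have hxB : x ∈ boundary N R := hact k x hx hex hxD
    have hsum := labelSum_add_sum_le hle {u, x} (by simp [Set.insert_subset_iff, huB, hxB])
    rw [Finset.sum_pair hne, Finset.sum_pair hne] at hsum
    have hx' := hg.le ((H.spec k).le_max x hx)
    omega
  · have hsum := labelSum_add_sum_le hle {u} (by simpa using huB)
    rw [Finset.sum_singleton, Finset.sum_singleton] at hsum
    omega

theorem eligible_step (H : Fusion N R D d fk f' d') (hg : GlobalGap D d' d'')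
    (hact : ActiveInBoundary N R D d) (hv : Eligible (N.residual f') R D d'' v) :
    ∃ x, Eligible N R D d x ∧
      d'' v + 1 + labelSum (boundary N R) d ≤ d x + labelSum (boundary N R) d'' := by
  obtain ⟨k, u, hu, hvu, w, hlt⟩ := H.exists_lt_flow_of_eligible hg hv
  obtain ⟨j, z, hz, huz, y, hpos⟩ := H.exists_inflow_of_lt_flow hg hu hlt
  obtain ⟨x, hx, hle⟩ := H.exists_eligible_of_inflow hg hact hz hpos
  exact ⟨x, hx, by omega⟩

end Fusion

end Potential

section Saturate

variable {N : Network V}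

theorem saturate_source {v : V} (hv : v ≠ N.s) (hE : N.E N.s v) : saturate N N.s v = N.c N.s v :=
  if_pos ⟨rfl, hv, hE⟩

theorem saturate_le_capacity (hN : N.Nonneg) {u v : V} (hE : N.E u v) :
    saturate N u v ≤ N.c u v := by
  have huv := hN.1 u v hE
  have hvu := hN.1 v u (N.symm _ _ hE)
  unfold saturate
  split_ifs <;> omega

theorem saturate_nonneg (hN : N.Nonneg) {u v : V} (hv : v ≠ N.s) : 0 ≤ saturate N u v := by
  unfold saturate
  split_ifs with hu hv'
  · exact hN.1 u v hu.2.2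
  · exact absurd hv'.1 hv
  · exact le_rfl

theorem residual_saturate_nonneg [Fintype V] (hN : N.Nonneg) :
    (N.residual (saturate N)).Nonneg :=
  ⟨fun _ _ hE => sub_nonneg.2 (saturate_le_capacity hN hE), fun v hs ht =>
    add_nonneg (hN.2 v hs ht) (Finset.sum_nonneg fun _ _ => saturate_nonneg hN hs)⟩

theorem residual_saturate_sourceSaturated [Fintype V] (N : Network V) :
    (N.residual (saturate N)).SourceSaturated :=
  fun _ hv hE => sub_eq_zero.2 (saturate_source (N := N) hv hE).symm

end Saturate

section Loop

variable {K : ℕ} {R : Fin K → Set V}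

theorem exists_regionIndex (hR : ∀ j k, j ≠ k → Disjoint (R j) (R k)) :
    ∃ r : V → Option (Fin K), ∀ v k, r v = some k ↔ v ∈ R k := by
  classical
  refine ⟨fun v => if h : ∃ k, v ∈ R k then some h.choose else none, fun v k => ?_⟩
  simp only
  by_cases h : ∃ k, v ∈ R k
  · rw [dif_pos h, Option.some_inj]
    refine ⟨fun hk => hk ▸ h.choose_spec, fun hk => ?_⟩
    by_contra hne
    exact (hR _ _ hne).notMem_of_mem_left h.choose_spec hk
  · simpa only [dif_neg h, reduceCtorEq, false_iff] using not_exists.1 h k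

theorem exists_fusedLabels (hR : ∀ j k, j ≠ k → Disjoint (R j) (R k)) (d : V → ℕ)
    (dk : Fin K → V → ℕ) : ∃ d', FusedLabels R d dk d' := by
  obtain ⟨r, hr⟩ := exists_regionIndex hR
  refine ⟨fun v => (r v).elim (d v) (dk · v), fun k v hv => ?_, fun v hv => ?_⟩
  · simp only [(hr v k).2 hv, Option.elim_some]
  · have hnone : r v = none := Option.eq_none_iff_forall_ne_some.2 fun k hk => hv k ((hr v k).1 hk)
    simp only [hnone, Option.elim_none]

theorem exists_fusedFlow {N : Network V} (hR : IsRegionPartition N R) (d' : V → ℕ)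
    (fk : Fin K → V → V → ℤ) : ∃ f', FusedFlow N R d' fk f' := by
  obtain ⟨r, hr⟩ := exists_regionIndex hR.1
  have hsome : ∀ {k v}, v ∈ R k → r v = some k := fun {k v} hv => (hr v k).2 hv
  have hnone : ∀ {v}, v = N.s ∨ v = N.t → r v = none := fun {v} hv =>
    Option.eq_none_iff_forall_ne_some.2 fun k hk =>
      not_or.2 ((hR.2 v).1 ⟨k, (hr v k).1 hk⟩) hv
  refine ⟨fun u v => match r u, r v with
    | some k, some j => if k = j then fk k u v else
        validPair d' v u * fk k u v + validPair d' u v * fk j u v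
    | some k, none => fk k u v
    | none, some k => fk k u v
    | none, none => 0, ?_, ?_, ?_, ?_⟩
  · intro k j hkj u hu v hv
    simp only [hsome hu, hsome hv, if_neg hkj]
  · intro k u hu v hv
    simp only [hsome hu, hsome hv, if_true]
  · intro k u hu v hv
    simp only [hsome hu, hnone hv, and_self]
  · intro u v hu hv
    simp only [hnone hu, hnone hv]

variable {B : Set V} {S S' : AlgState V}

/-- The invariant of the main loop, where `B` is the set of all boundary vertices. -/
structure LoopInv (R : Fin K → Set V) (B : Set V) (S : AlgState V) : Prop where
  part : IsRegionPartition S.net R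
  boundary_eq : boundary S.net R = B
  nonneg : S.net.Nonneg
  saturated : S.net.SourceSaturated
  valid : ∀ k, IsValidLabeling S.net (R k) (dInf S.net R) S.d

namespace LoopInv

theorem dInf_eq (h : LoopInv R B S) : dInf S.net R = B.ncard := by
  rw [dInf, h.boundary_eq]

theorem le_ncard (h : LoopInv R B S) {k : Fin K} {v : V} (hv : v ∈ R k) : S.d v ≤ B.ncard :=
  ((h.valid k).le_max v hv).trans_eq h.dInf_eq

end LoopInv

variable [Fintype V]

theorem loopInv_initState {N : Network V} (hN : N.Nonneg) (hR : IsRegionPartition N R) :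
    LoopInv R (boundary N R) (initState N R) := by
  have hd : ∀ k, ∀ v ∈ R k, (initState N R).d v = 0 := fun k v hv =>
    if_neg ((hR.2 v).1 ⟨k, hv⟩).1
  exact
    { part := hR
      boundary_eq := rfl
      nonneg := residual_saturate_nonneg hN
      saturated := residual_saturate_sourceSaturated N
      valid k :=
        { le_max v hv := (hd k v hv).trans_le (Nat.zero_le _)
          inner u hu _ _ _ := (hd k u hu).trans_le (Nat.zero_le _)
          outer u hu _ _ _ := (hd k u hu).trans_le (Nat.zero_le _)
          sink u hu _ := hd k u hu } }

namespace LoopInv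

theorem exists_fusion (h : LoopInv R B S) (hS : Sweep R S S') :
    ∃ fk f' d', Fusion S.net R (dInf S.net R) S.d fk f' d' ∧
      S'.net = S.net.residual f' ∧ GlobalGap (dInf S.net R) d' S'.d := by
  obtain ⟨fk, dk, f', d', hard, hlabels, hflow, hnet, hgap⟩ := hS
  refine ⟨fk, f', d', ⟨h.part, h.nonneg, h.saturated, fun k => ?_, hflow⟩, hnet, hgap⟩
  refine (hard k).1.spec (fun v hv => ?_) h.nonneg h.saturated (h.part.source_notMem k)
    (h.part.sink_notMem k) (h.valid k)
  rw [hlabels.1 k v hv, (hard k).2]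

theorem exists_sweep (h : LoopInv R B S) : ∃ S', Sweep R S S' := by
  choose fk hfk using fun k => exists_ardStages (d := S.d) h.nonneg (h.part.source_notMem k)
    (h.part.sink_notMem k) (dInf S.net R + 1)
  obtain ⟨d', hd'⟩ := exists_fusedLabels h.part.1 S.d
    fun k => regionRelabel S.net (R k) (dInf S.net R) S.d (fk k)
  obtain ⟨f', hf'⟩ := exists_fusedFlow h.part d' fk
  exact ⟨⟨S.net.residual f', d'⟩, fk, _, f', d', fun k => ⟨hfk k, rfl⟩, hd', hf', rfl, .inl rfl⟩

theorem augmentTerminates (h : LoopInv R B S) {k : Fin K} {j : ℕ} {f : V → V → ℤ}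
    (hf : ARDStages S.net (R k) S.d j f) :
    AugmentTerminates (S.net.region (R k)) (R k) (target S.net (R k) S.d j) f :=
  have ht := h.part.sink_notMem k
  augmentTerminates_of_disjoint (disjoint_target ht)
    (hf.stageInv h.nonneg (h.part.source_notMem k) ht j.le_succ).flow

theorem sweep (h : LoopInv R B S) (hS : Sweep R S S') : LoopInv R B S' := by
  obtain ⟨fk, f', d', H, hnet, hgap⟩ := h.exists_fusion hS
  obtain ⟨N', d''⟩ := S'
  obtain rfl : N' = _ := hnet
  exact ⟨h.part, h.boundary_eq, H.residual_nonneg, H.residual_sourceSaturated,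
    fun k => (H.isValidLabeling k).globalGap hgap⟩

theorem of_reflTransGen (h : LoopInv R B S) (hS : Relation.ReflTransGen (LoopStep R) S S') :
    LoopInv R B S' := by
  induction hS with
  | refl => exact h
  | tail _ hstep ih => exact ih.sweep hstep.2

theorem activeInBoundary (h : LoopInv R B S) (hS : Sweep R S S') :
    ActiveInBoundary S'.net R B.ncard S'.d := by
  obtain ⟨fk, f', d', H, hnet, hgap⟩ := h.exists_fusion hS
  rw [hnet, ← h.dInf_eq]
  exact H.activeInBoundary hgap

theorem eligible_step (h : LoopInv R B S) (hS : Sweep R S S')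
    (hact : ActiveInBoundary S.net R B.ncard S.d) {v : V}
    (hv : Eligible S'.net R B.ncard S'.d v) :
    ∃ x, Eligible S.net R B.ncard S.d x ∧
      S'.d v + 1 + labelSum B S.d ≤ S.d x + labelSum B S'.d := by
  obtain ⟨fk, f', d', H, hnet, hgap⟩ := h.exists_fusion hS
  rw [← h.dInf_eq] at *
  rw [hnet] at hv
  rw [← h.boundary_eq]
  exact H.eligible_step hgap hact hv

end LoopInv

variable {σ : ℕ → AlgState V} {n : ℕ}

theorem LoopInv.iterate (h : LoopInv R B (σ 0)) (hσ : ∀ i < n, Sweep R (σ i) (σ (i + 1))) :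
    ∀ i ≤ n, LoopInv R B (σ i) := by
  intro i hi
  induction i with
  | zero => exact h
  | succ i ih => exact (ih (by omega)).sweep (hσ i hi)

theorem add_le_labelSum_of_eligible (h : LoopInv R B (σ 0))
    (hσ : ∀ i < n + 1, Sweep R (σ i) (σ (i + 1))) {x : V}
    (hx : Eligible (σ (n + 1)).net R B.ncard (σ (n + 1)).d x) :
    n + (σ (n + 1)).d x ≤ labelSum B (σ (n + 1)).d + B.ncard := by
  induction n generalizing x with
  | zero =>
    obtain ⟨k, hk, -⟩ := hx
    have := (h.iterate hσ (0 + 1) le_rfl).le_ncard hk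
    omega
  | succ n ih =>
    have hact := (h.iterate hσ n (by omega)).activeInBoundary (hσ n (by omega))
    obtain ⟨y, hy, hle⟩ :=
      (h.iterate hσ (n + 1) (by omega)).eligible_step (hσ (n + 1) (by omega)) hact hx
    have := ih (fun i hi => hσ i (by omega)) hy
    omega

theorem sweeps_le (h : LoopInv R B (σ 0)) (hσ : ∀ i < n, LoopStep R (σ i) (σ (i + 1))) :
    n ≤ B.ncard ^ 2 + B.ncard + 1 := by
  obtain hn | ⟨m, rfl⟩ : n ≤ 1 ∨ ∃ m, n = m + 2 := by
    rcases Nat.lt_or_ge n 2 with hn | hn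
    · exact .inl (by omega)
    · exact .inr (Nat.exists_eq_add_of_le' hn)
  · exact hn.trans (Nat.le_add_left _ _)
  have hsweep : ∀ i < m + 1, Sweep R (σ i) (σ (i + 1)) := fun i hi => (hσ i (by omega)).2
  have hinv := h.iterate hsweep
  have hm := hinv (m + 1) le_rfl
  obtain ⟨x, hxs, hxt, hxe, hxd⟩ := (hσ (m + 1) (by omega)).1
  rw [hm.dInf_eq] at hxd
  obtain ⟨k, hk⟩ := (hm.part.2 x).2 ⟨hxs, hxt⟩
  have hxB : x ∈ B := hm.boundary_eq ▸
    (hinv m (by omega)).activeInBoundary (hsweep m (by omega)) k x hk hxe hxd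
  have hle : ∀ v ∈ B, (σ (m + 1)).d v ≤ B.ncard := fun v hv =>
    let ⟨_, hj⟩ := hm.part.exists_mem_of_mem_boundary (hm.boundary_eq.symm ▸ hv)
    hm.le_ncard hj
  have hlt := labelSum_lt hle hxB hxd
  have hpot := add_le_labelSum_of_eligible h hsweep ⟨k, hk, hxe, .inl hxd⟩
  rw [sq]
  omega

end Loop

end PARD

theorem mainTheorem2 {V : Type*} [Fintype V] (N : PARD.Network V) (hN : N.Nonneg)
    {K : ℕ} (R : Fin K → Set V) (hR : PARD.IsRegionPartition N R) :
    -- every execution makes at most `2|𝓑|² + 1` sweeps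
    (∀ (n : ℕ) (σ : ℕ → PARD.AlgState V), σ 0 = PARD.initState N R →
      (∀ i < n, PARD.LoopStep R (σ i) (σ (i + 1))) →
      n ≤ 2 * (PARD.boundary N R).ncard ^ 2 + 1) ∧
    -- and every sweep terminates: no augmentation loop runs forever, and a next state is reached
    (∀ S : PARD.AlgState V,
      Relation.ReflTransGen (PARD.LoopStep R) (PARD.initState N R) S → PARD.HasActive R S →
      (∀ k : Fin K, ∀ j ≤ (PARD.boundary N R).ncard, ∀ f : V → V → ℤ,
        PARD.ARDStages S.net (R k) S.d j f →
        PARD.AugmentTerminates (S.net.region (R k)) (R k) (PARD.target S.net (R k) S.d j) f) ∧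
      ∃ S' : PARD.AlgState V, PARD.Sweep R S S') := by
  have hinit := PARD.loopInv_initState hN hR
  refine ⟨fun n σ hσ0 hσ => ?_, fun S hS _ => ?_⟩
  · have hle := PARD.sweeps_le (hσ0.symm ▸ hinit) hσ
    have hsq := Nat.le_self_pow two_ne_zero (PARD.boundary N R).ncard
    omega
  · have hinv := hinit.of_reflTransGen hS
    exact ⟨fun k j _ f hf => hinv.augmentTerminates hf, hinv.exists_sweep⟩
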